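/- Let the scalar field be $\mathbb{R}$ or $\mathbb{C}$. A Banach space $X$ is finitely representable in a Banach space $Y$ if for every $\varepsilon>0$ and every finite-dimensional subspace $A\subseteq X$ there are a subspace $B\subseteq Y$ and an isomorphism $u:A\to B$ with $\|u\|\,\|u^{-1}\|\le 1+\varepsilon$; $X^{f}$ denotes the class of all Banach spaces $Y$ such that each of $X$ and $Y$ is finitely representable in the other. A subspace $Y$ of a Banach space $Z$ is reflecting if for every $\varepsilon>0$ and every finite-dimensional subspace $A\subseteq Z$ there is an isomorphic embedding $u:A\to Y$ with $\|u\|\,\|u^{-1}\|\le 1+\varepsilon$ and $u(a)=a$ for all $a\in A\cap Y$. A Banach space $E$ is existentially closed in $X^{f}$ if $E\in X^{f}$ and, for every $Z\in X^{f}$ and every linear isometric embedding $i:E\to Z$, the image $iE$ is a reflecting subspace of $Z$; the class of all such $E$ is denoted by $\mathcal{E}(X^{f})$. The dimension $\dim(X)$ is the least cardinality of a subset of $X$ whose linear span is dense in $X$. **Theorem.** For every infinite-dimensional Banach space $X$ the class $\mathcal{E}(X^{f})$ of all Banach spaces existentially closed in $X^{f}$ is non-empty. Moreover, every $Y\in X^{f}$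 embeds linearly and isometrically into some $E\in\mathcal{E}(X^{f})$ with $\dim(E)=\dim(Y)$. -/

import Mathlib

universe u v w

/-- The dimension of a Banach space: the least cardinality of a subset whose linear span is
dense. -/
noncomputable def banachDim (𝕜 : Type v) (X : Type u) [RCLike 𝕜] [NormedAddCommGroup X]
    [NormedSpace 𝕜 X] : Cardinal.{u} :=
  sInf {c : Cardinal.{u} | ∃ A : Set X, Cardinal.mk A = c ∧
    Dense (Submodule.span 𝕜 A : Set X)}

/-- `X` is finitely representable in `Y`: for each `ε > 0`, every finite-dimensional subspace `A`
of `X` admits an isomorphism `u` onto a subspace `B` of `Y` with `‖u‖ ‖u⁻¹‖ ≤ 1 + ε`. -/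
def FinitelyRepresentable (𝕜 : Type v) (X : Type u) (Y : Type w) [RCLike 𝕜]
    [NormedAddCommGroup X] [NormedSpace 𝕜 X] [NormedAddCommGroup Y] [NormedSpace 𝕜 Y] : Prop :=
  ∀ ε : ℝ, 0 < ε → ∀ A : Submodule 𝕜 X, FiniteDimensional 𝕜 A →
    ∃ (B : Submodule 𝕜 Y) (u : A ≃L[𝕜] B),
      ‖(u : A →L[𝕜] B)‖ * ‖(u.symm : B →L[𝕜] A)‖ ≤ 1 + ε

/-- Finite equivalence. The class `X^f` consists of the Banach spaces `Y` with
`FinitelyEquivalent 𝕜 X Y`. -/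
def FinitelyEquivalent (𝕜 : Type v) (X : Type u) (Y : Type w) [RCLike 𝕜]
    [NormedAddCommGroup X] [NormedSpace 𝕜 X] [NormedAddCommGroup Y] [NormedSpace 𝕜 Y] : Prop :=
  FinitelyRepresentable 𝕜 X Y ∧ FinitelyRepresentable 𝕜 Y X

/-- `Y` is a reflecting subspace of `X`: for every `ε > 0` and every finite-dimensional subspace
`A` of `X` there is an isomorphic embedding `u` of `A` into `Y` (an isomorphism of `A` onto a
subspace `B` of `Y`) with `‖u‖ ‖u⁻¹‖ ≤ 1 + ε` which is the identity on `A ∩ Y`. -/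
def IsReflecting (𝕜 : Type v) {X : Type u} [RCLike 𝕜] [NormedAddCommGroup X] [NormedSpace 𝕜 X]
    (Y : Submodule 𝕜 X) : Prop :=
  ∀ ε : ℝ, 0 < ε → ∀ A : Submodule 𝕜 X, FiniteDimensional 𝕜 A →
    ∃ B : Submodule 𝕜 X, B ≤ Y ∧ ∃ u : A ≃L[𝕜] B,
      ‖(u : A →L[𝕜] B)‖ * ‖(u.symm : B →L[𝕜] A)‖ ≤ 1 + ε ∧
      ∀ a : A, (a : X) ∈ Y → (u a : X) = (a : X)

/-- `E` is existentially closed in the class `X^f`: it belongs to `X^f`, and its image under any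
isometric embedding into any Banach space `Z` of `X^f` is a reflecting subspace of `Z`.
(Without the membership in `X^f`, spaces which embed into no member of `X^f` would qualify
vacuously.) -/
def IsExistentiallyClosed (𝕜 : Type v) (X E : Type u) [RCLike 𝕜]
    [NormedAddCommGroup X] [NormedSpace 𝕜 X] [NormedAddCommGroup E] [NormedSpace 𝕜 E] : Prop :=
  FinitelyEquivalent 𝕜 X E ∧
    ∀ (Z : Type u) [NormedAddCommGroup Z] [NormedSpace 𝕜 Z] [CompleteSpace Z],
      FinitelyEquivalent 𝕜 X Z →
        ∀ i : E →ₗᵢ[𝕜] Z, IsReflecting 𝕜 (LinearMap.range i.toLinearMap)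

/-! All candidate extensions of `Y` are described by seminorms on one free space. Let `I` be a
subset of `Y` with dense span and of size dim `Y`, and let `W` have a basis indexed by `I × ℕ`. The
seminorms on `W` that are at most 1 on the basis and are pointwise limits of functions `‖T ·‖`, with
`T : W → X` linear, form a compact set (`isCompact_repSeminorms`), and completing `W` for any of
them gives a space finitely representable in `X`.

Reflection reduces to finite systems of constraints `r ≤ ‖z‖ ≤ s` with rational bounds and
coefficients from a dense sequence (`isReflecting_range_of_solves`). There are only `#I` such
systems, so each can own basis vectors reserved for its unknowns, one level above its parameters.
Each system is a closed condition on the seminorm, so compactness and Zorn's lemma give, level by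
level, a seminorm for which the set of systems solved by their reserved vectors is maximal
(`exists_maximal_repSeminorm`).

If an extension `Z` in the class solves a system in its unit ball, then sending only the reserved
vectors of that system to the solution gives another admissible seminorm that loses no system of the
same level. By maximality the system was solved already (`NormProblem.solves_of_extension`). At
level 0 the seminorm is the norm of `Y`, so the completion contains `Y`; its dimension is at most
`#(I × ℕ) = #I`. -/

open Set Cardinal

/-! ### Almost isometries on finite-dimensional spaces -/

/-- A linear map out of a finite-dimensional space that almost preserves the norm of finitely many
suitable vectors almost preserves all norms. -/
theorem exists_finite_almost_isometry {𝕜 : Type*} [RCLike 𝕜] (A : Type*) [NormedAddCommGroup A]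
    [NormedSpace 𝕜 A] [FiniteDimensional 𝕜 A] {ε : ℝ} (hε : 0 < ε) :
    ∃ F : Set A, F.Finite ∧ ∃ δ : ℝ, 0 < δ ∧
      ∀ (W : Type w) [NormedAddCommGroup W] [NormedSpace 𝕜 W] (T : A →ₗ[𝕜] W),
        (∀ f ∈ F, |‖T f‖ - ‖f‖| ≤ δ) → ∀ a, |‖T a‖ - ‖a‖| ≤ ε * ‖a‖ := by
  have : ProperSpace A := FiniteDimensional.proper_rclike 𝕜 A
  obtain ⟨δ, hδ, hδ2, hδε⟩ : ∃ δ : ℝ, 0 < δ ∧ δ ≤ 1 / 2 ∧ 5 * δ ≤ ε :=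
    ⟨min (1 / 2) (ε / 5), by positivity, min_le_left _ _, by
      linarith [min_le_right (1 / 2) (ε / 5)]⟩
  obtain ⟨F, hFs, hFf, hF⟩ :=
    (isCompact_sphere (0 : A) 1).finite_cover_balls hδ
  refine ⟨F, hFf, δ, hδ, fun W _ _ T hT => ?_⟩
  set S : A →L[𝕜] W := LinearMap.toContinuousLinearMap T with hS
  have hST : ∀ a, T a = S a := fun a => rfl
  have near : ∀ a : A, ‖a‖ = 1 → ∃ f ∈ F, ‖f‖ = 1 ∧ ‖a - f‖ ≤ δ := by
    intro a ha
    have := hF (show a ∈ Metric.sphere (0 : A) 1 by simpa using ha)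
    simp only [mem_iUnion, Metric.mem_ball, exists_prop] at this
    obtain ⟨f, hf, hd⟩ := this
    exact ⟨f, hf, by simpa using hFs hf, by rw [← dist_eq_norm]; exact hd.le⟩
  have scale : ∀ a : A, a ≠ 0 → ‖T a‖ = ‖a‖ * ‖T (((‖a‖⁻¹ : ℝ) : 𝕜) • a)‖ := by
    intro a ha
    have : ‖a‖ ≠ 0 := norm_ne_zero_iff.2 ha
    rw [map_smul, norm_smul, RCLike.norm_ofReal, abs_of_nonneg (by positivity)]
    field_simp
  have unit : ∀ a : A, a ≠ 0 → ‖(((‖a‖⁻¹ : ℝ) : 𝕜) • a)‖ = 1 := by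
    intro a ha
    have : ‖a‖ ≠ 0 := norm_ne_zero_iff.2 ha
    rw [norm_smul, RCLike.norm_ofReal, abs_of_nonneg (by positivity)]
    field_simp
  have diff : ∀ a f : A, ‖a - f‖ ≤ δ → |‖T a‖ - ‖T f‖| ≤ ‖S‖ * δ := by
    intro a f h
    calc |‖T a‖ - ‖T f‖| ≤ ‖T a - T f‖ := abs_norm_sub_norm_le _ _
      _ = ‖S (a - f)‖ := by rw [← map_sub]; rfl
      _ ≤ ‖S‖ * ‖a - f‖ := S.le_opNorm _
      _ ≤ ‖S‖ * δ := by gcongr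
  have hSn : ‖S‖ ≤ 3 := by
    -- The net bounds the norm in terms of itself; `δ ≤ 1 / 2` absorbs the last term and gives 3.
    -- The final error is then at most `δ + 3 * δ`.
    have : ‖S‖ ≤ 1 + δ + ‖S‖ * δ := by
      refine S.opNorm_le_bound (by positivity) fun a => ?_
      rcases eq_or_ne a 0 with rfl | ha
      · simp
      rw [← hST, scale a ha, mul_comm]
      gcongr
      obtain ⟨f, hf, hf1, hd⟩ := near _ (unit a ha)
      have h1 := abs_le.1 (hT f hf)
      have h2 := abs_le.1 (diff _ f hd)
      linarith [h1.2, h2.2]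
    nlinarith [norm_nonneg S]
  intro a
  rcases eq_or_ne a 0 with rfl | ha
  · simp
  rw [scale a ha]
  obtain ⟨f, hf, hf1, hd⟩ := near _ (unit a ha)
  have h1 := abs_le.1 (hT f hf)
  have h2 := abs_le.1 (diff _ f hd)
  have h3 : ‖S‖ * δ ≤ 3 * δ := by gcongr
  have : ∀ t : ℝ, ‖a‖ * t - ‖a‖ = (t - 1) * ‖a‖ := fun t => by ring
  rw [this, abs_mul, abs_norm]
  gcongr
  rw [abs_le]
  constructor <;> linarith [h1.1, h1.2, h2.1, h2.2]

/-- An almost isometric linear map is an isomorphism of small distortion onto its range. -/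
theorem exists_equiv_range_of_almost_isometry {𝕜 : Type*} [RCLike 𝕜] {A Z : Type*}
    [NormedAddCommGroup A] [NormedSpace 𝕜 A] [FiniteDimensional 𝕜 A] [NormedAddCommGroup Z]
    [NormedSpace 𝕜 Z] {ε η : ℝ} (hη : 0 < η) (hη1 : η < 1) (hηε : (1 + η) / (1 - η) ≤ 1 + ε)
    (T : A →ₗ[𝕜] Z) (hT : ∀ a, |‖T a‖ - ‖a‖| ≤ η * ‖a‖) :
    ∃ u : A ≃L[𝕜] LinearMap.range T,
      ‖(u : A →L[𝕜] LinearMap.range T)‖ * ‖(u.symm : LinearMap.range T →L[𝕜] A)‖ ≤ 1 + ε ∧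
      ∀ a, (u a : Z) = T a := by
  have h1η : 0 < 1 - η := by linarith
  have lower : ∀ a, (1 - η) * ‖a‖ ≤ ‖T a‖ := fun a => by linarith [(abs_le.1 (hT a)).1]
  have inj : Function.Injective T := by
    rw [← LinearMap.ker_eq_bot, LinearMap.ker_eq_bot']
    intro a ha
    have := lower a
    rw [ha, norm_zero] at this
    exact norm_le_zero_iff.1 (by nlinarith [norm_nonneg a])
  have hu : ∀ a, ((LinearEquiv.ofInjective T inj).toContinuousLinearEquiv a : Z) = T a :=
    fun a => rfl
  refine ⟨(LinearEquiv.ofInjective T inj).toContinuousLinearEquiv, ?_, hu⟩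
  set u := (LinearEquiv.ofInjective T inj).toContinuousLinearEquiv
  refine le_trans (mul_le_mul (ContinuousLinearMap.opNorm_le_bound _ (M := 1 + η) (by positivity)
    fun a => ?_) (ContinuousLinearMap.opNorm_le_bound _ (M := (1 - η)⁻¹) (by positivity)
    fun a => ?_) (norm_nonneg _) (by positivity)) (by rwa [← div_eq_mul_inv])
  · have : ‖u a‖ = ‖T a‖ := by rw [← hu]; rfl
    simp only [ContinuousLinearEquiv.coe_coe]
    rw [this]
    linarith [(abs_le.1 (hT a)).2]
  · obtain ⟨a, rfl⟩ := u.surjective a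
    have : ‖u a‖ = ‖T a‖ := by rw [← hu]; rfl
    simp only [ContinuousLinearEquiv.coe_coe, ContinuousLinearEquiv.symm_apply_apply]
    rw [this, inv_mul_eq_div, le_div_iff₀ h1η, mul_comm]
    exact lower a

theorem exists_distortion_lt {ε : ℝ} (hε : 0 < ε) :
    ∃ η : ℝ, 0 < η ∧ η < 1 ∧ (1 + η) / (1 - η) ≤ 1 + ε := by
  -- This is the solution of `(1 + η) / (1 - η) = 1 + ε`.
  refine ⟨ε / (2 + ε), by positivity, ?_, ?_⟩
  · rw [div_lt_one (by positivity)]; linarith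
  · rw [show 1 - ε / (2 + ε) = 2 / (2 + ε) by field_simp; ring,
      show 1 + ε / (2 + ε) = (2 + 2 * ε) / (2 + ε) by field_simp; ring]
    field_simp
    linarith

/-! ### Finite representability tested on finite sets -/

section

variable {𝕜 : Type v} [RCLike 𝕜] {X : Type u} {Y : Type w} [NormedAddCommGroup X]
  [NormedSpace 𝕜 X] [NormedAddCommGroup Y] [NormedSpace 𝕜 Y]

/-- Together with `FinitelyRepresentable.exists_linearMap`, this trades distortion for approximation
of finitely many norms, a condition suited to pointwise limits. -/
theorem finitelyRepresentable_of_finite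
    (h : ∀ A : Submodule 𝕜 X, FiniteDimensional 𝕜 A → ∀ F : Set A, F.Finite → ∀ δ : ℝ, 0 < δ →
      ∃ T : A →ₗ[𝕜] Y, ∀ f ∈ F, |‖T f‖ - ‖f‖| ≤ δ) :
    FinitelyRepresentable 𝕜 X Y := by
  intro ε hε A hA
  obtain ⟨η, hη, hη1, hηε⟩ := exists_distortion_lt hε
  obtain ⟨F, hF, δ, hδ, key⟩ := exists_finite_almost_isometry (𝕜 := 𝕜) A hη
  obtain ⟨T, hT⟩ := h A hA F hF δ hδ
  obtain ⟨u, hu, -⟩ := exists_equiv_range_of_almost_isometry hη hη1 hηε T (key Y T hT)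
  exact ⟨_, u, hu⟩

theorem FinitelyRepresentable.exists_linearMap (h : FinitelyRepresentable 𝕜 X Y) {F : Set X}
    (hF : F.Finite) {δ : ℝ} (hδ : 0 < δ) :
    ∃ T : X →ₗ[𝕜] Y, ∀ f ∈ F, |‖T f‖ - ‖f‖| ≤ δ := by
  obtain ⟨R, hR⟩ := (hF.image norm).bddAbove
  have hR' : ∀ f ∈ F, ‖f‖ ≤ |R| := fun f hf => (hR (mem_image_of_mem _ hf)).trans (le_abs_self R)
  obtain ⟨B, u, hu⟩ := h (δ / (|R| + 1)) (by positivity) (Submodule.span 𝕜 F)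
    (FiniteDimensional.span_of_finite 𝕜 hF)
  set c := ‖(u.symm : B →L[𝕜] Submodule.span 𝕜 F)‖
  have hc : 0 ≤ c := norm_nonneg _
  -- Rescaling by `c = ‖u⁻¹‖` puts `‖T f‖` between `‖f‖` and `(1 + δ / (|R| + 1)) * ‖f‖`.
  obtain ⟨T, hT⟩ := LinearMap.exists_extend
    (((c : ℝ) : 𝕜) • (B.subtype ∘ₗ (u : Submodule.span 𝕜 F →ₗ[𝕜] B)))
  refine ⟨T, fun f hf => ?_⟩
  set f' : Submodule.span 𝕜 F := ⟨f, Submodule.subset_span hf⟩ with hf'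
  have hn : ‖f'‖ = ‖f‖ := rfl
  have h0 : T f = ((c : ℝ) : 𝕜) • (u f' : Y) := by
    have := LinearMap.congr_fun hT f'
    simpa using this
  have h1 : ‖T f‖ = c * ‖u f'‖ := by
    rw [h0, norm_smul, RCLike.norm_ofReal, abs_of_nonneg hc]; rfl
  have h2 : ‖f'‖ ≤ c * ‖u f'‖ := by
    simpa using (u.symm : B →L[𝕜] Submodule.span 𝕜 F).le_opNorm (u f')
  have h3 : c * ‖u f'‖ ≤ (1 + δ / (|R| + 1)) * ‖f'‖ := by
    refine le_trans (mul_le_mul_of_nonneg_left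
      ((u : Submodule.span 𝕜 F →L[𝕜] B).le_opNorm f') hc) ?_
    rw [← mul_assoc]
    gcongr
    rwa [mul_comm]
  have h4 : δ / (|R| + 1) * ‖f‖ ≤ δ := by
    rw [div_mul_eq_mul_div, div_le_iff₀ (by positivity)]
    have := hR' f hf
    nlinarith
  rw [h1, abs_le]
  rw [hn] at h2 h3
  constructor <;> linarith

theorem FinitelyRepresentable.refl (X : Type u) [NormedAddCommGroup X] [NormedSpace 𝕜 X] :
    FinitelyRepresentable 𝕜 X X :=
  finitelyRepresentable_of_finite fun A _ F _ δ hδ => ⟨A.subtype, fun f _ => by simp [hδ.le]⟩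

theorem FinitelyRepresentable.comp_isometry {Z : Type*} [NormedAddCommGroup Z] [NormedSpace 𝕜 Z]
    (h : FinitelyRepresentable 𝕜 X Y) (j : Y →ₗᵢ[𝕜] Z) : FinitelyRepresentable 𝕜 X Z := by
  refine finitelyRepresentable_of_finite fun A _ F hF δ hδ => ?_
  obtain ⟨T, hT⟩ := h.exists_linearMap (hF.image A.subtype) hδ
  refine ⟨j.toLinearMap ∘ₗ T ∘ₗ A.subtype, fun f hf => ?_⟩
  simpa using hT _ (mem_image_of_mem _ hf)

/-- Finite representability may be tested on a dense image of a vector space. -/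
theorem finitelyRepresentable_of_denseRange {W : Type*} [AddCommGroup W] [Module 𝕜 W]
    (φ : W →ₗ[𝕜] X) (hφ : DenseRange φ)
    (h : ∀ F : Set W, F.Finite → ∀ δ : ℝ, 0 < δ →
      ∃ T : W →ₗ[𝕜] Y, ∀ w ∈ F, |‖T w‖ - ‖φ w‖| ≤ δ) :
    FinitelyRepresentable 𝕜 X Y := by
  refine finitelyRepresentable_of_finite fun A _ F hF δ hδ => ?_
  let b := Module.finBasis 𝕜 A
  obtain ⟨R, hR⟩ := (hF.image fun f => ∑ i, ‖b.repr f i‖).bddAbove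
  have hR' : ∀ f ∈ F, ∑ i, ‖b.repr f i‖ ≤ |R| :=
    fun f hf => (hR (mem_image_of_mem _ hf)).trans (le_abs_self R)
  have hρ : 0 < δ / 2 / (|R| + 1) := by positivity
  -- Moving the basis of `A` into the image of `φ` displaces each `f ∈ F` by at most `δ / 2`, since
  -- `R` bounds the coordinate sums.
  choose w hw using fun i => hφ.exists_dist_lt (b i : X) hρ
  let V : A →ₗ[𝕜] W := b.constr 𝕜 w
  have hV : ∀ f ∈ F, ‖φ (V f) - f‖ ≤ δ / 2 := by
    intro f hf
    have e1 : V f = ∑ i, b.repr f i • w i := by simp [V, Module.Basis.constr_apply_fintype]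
    have e2 : (f : X) = ∑ i, b.repr f i • (b i : X) := by
      have := congrArg A.subtype (b.sum_repr f)
      rw [map_sum] at this
      simpa only [map_smul, Submodule.subtype_apply] using this.symm
    calc ‖φ (V f) - f‖ = ‖∑ i, b.repr f i • (φ (w i) - (b i : X))‖ := by
          rw [e1]
          conv_lhs => rw [e2]
          simp [smul_sub]
      _ ≤ ∑ i, ‖b.repr f i‖ * (δ / 2 / (|R| + 1)) := by
          refine norm_sum_le_of_le _ fun i _ => ?_
          rw [norm_smul]
          gcongr
          rw [← dist_eq_norm, dist_comm]
          exact (hw i).le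
      _ ≤ |R| * (δ / 2 / (|R| + 1)) := by
          rw [← Finset.sum_mul]
          gcongr
          exact hR' f hf
      _ ≤ δ / 2 := by
          rw [mul_div_assoc', div_le_iff₀ (by positivity)]
          nlinarith
  obtain ⟨T, hT⟩ := h (V '' F) (hF.image _) (δ / 2) (by positivity)
  refine ⟨T ∘ₗ V, fun f hf => ?_⟩
  have h1 := abs_le.1 (hT _ (mem_image_of_mem _ hf))
  have h2 := abs_le.1 ((abs_norm_sub_norm_le _ _).trans (hV f hf))
  rw [LinearMap.comp_apply, abs_le]
  have : ‖f‖ = ‖(f : X)‖ := rfl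
  constructor <;> linarith [h1.1, h1.2, h2.1, h2.2]

end

theorem FinitelyRepresentable.not_finiteDimensional {𝕜 : Type v} [RCLike 𝕜] {X : Type u}
    {Y : Type w} [NormedAddCommGroup X] [NormedSpace 𝕜 X] [NormedAddCommGroup Y] [NormedSpace 𝕜 Y]
    (h : FinitelyRepresentable 𝕜 X Y) (hX : ¬ FiniteDimensional 𝕜 X) :
    ¬ FiniteDimensional 𝕜 Y := by
  intro hY
  have hr : ((Module.finrank 𝕜 Y + 1 : ℕ) : Cardinal) ≤ Module.rank 𝕜 X := by
    refine (Cardinal.natCast_lt_aleph0.le).trans (not_lt.1 fun hlt => hX ?_)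
    exact Module.rank_lt_aleph0_iff.1 hlt
  obtain ⟨v, hv⟩ := Module.le_rank_iff.1 hr
  obtain ⟨B, u, -⟩ := h 1 one_pos (Submodule.span 𝕜 (range v))
    (FiniteDimensional.span_of_finite 𝕜 (finite_range v))
  have h1 := finrank_span_eq_card hv
  have h2 := u.toLinearEquiv.finrank_eq
  have h3 := B.finrank_le
  rw [Fintype.card_fin] at h1
  omega

/-! ### Compactness and maximality -/

/-- A compact set contains a point that is maximal for the preorder comparing points by the
members of a family of closed sets containing them. -/
theorem IsCompact.exists_maximal_of_isClosed {α P : Type*} [TopologicalSpace α] {C : Set α}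
    (hC : IsCompact C) (hne : C.Nonempty) (R : P → Set α) (hR : ∀ p, IsClosed (R p)) :
    ∃ x ∈ C, ∀ y ∈ C, (∀ p, x ∈ R p → y ∈ R p) → ∀ p, y ∈ R p → x ∈ R p := by
  -- Zorn's lemma is applied to the sets of conditions that some point of `C` meets simultaneously;
  -- unions of chains stay in `𝒮` by the finite intersection property.
  let 𝒮 : Set (Set P) := {S | (C ∩ ⋂ p : S, R p).Nonempty}
  obtain ⟨S, hS⟩ : ∃ S, Maximal (· ∈ 𝒮) S := by
    refine zorn_subset 𝒮 fun c hc hchain => ⟨⋃₀ c, ?_, fun s hs => subset_sUnion_of_mem hs⟩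
    rcases c.eq_empty_or_nonempty with rfl | hcne
    · obtain ⟨x, hx⟩ := hne
      exact ⟨x, hx, by simp⟩
    refine hC.inter_iInter_nonempty _ (fun p => hR p) fun F => ?_
    obtain ⟨s, hs, hFs⟩ := hchain.directedOn.exists_mem_subset_of_finite_of_subset_sUnion hcne
      (s := Subtype.val '' (F : Set (⋃₀ c))) (F.finite_toSet.image _)
      (by rintro _ ⟨p, -, rfl⟩; exact p.2)
    obtain ⟨x, hxC, hx⟩ := hc hs
    refine ⟨x, hxC, mem_iInter₂.2 fun p hp => ?_⟩
    exact mem_iInter.1 hx ⟨p, hFs (mem_image_of_mem _ hp)⟩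
  obtain ⟨x, hxC, hx⟩ := hS.1
  refine ⟨x, hxC, fun y hy hxy p hp => ?_⟩
  have hT : insert p S ∈ 𝒮 := by
    refine ⟨y, hy, mem_iInter.2 ?_⟩
    rintro ⟨q, rfl | hq⟩
    · exact hp
    · exact hxy q (mem_iInter.1 hx ⟨q, hq⟩)
  exact mem_iInter.1 hx ⟨p, hS.2 hT (subset_insert _ _) (mem_insert _ _)⟩

theorem mem_closure_pi_real_iff {α : Type*} {R : Set (α → ℝ)} {N : α → ℝ} :
    N ∈ closure R ↔ ∀ F : Set α, F.Finite → ∀ δ : ℝ, 0 < δ →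
      ∃ g ∈ R, ∀ a ∈ F, |g a - N a| < δ := by
  constructor
  · intro h F hF δ hδ
    have : F.pi (fun a => Metric.ball (N a) δ) ∈ nhds N :=
      set_pi_mem_nhds hF fun a _ => Metric.ball_mem_nhds _ hδ
    obtain ⟨g, hg, hgR⟩ := mem_closure_iff_nhds.1 h _ this
    exact ⟨g, hgR, fun a ha => by simpa [Real.dist_eq] using hg a ha⟩
  · intro h
    refine mem_closure_iff.2 fun o ho hN => ?_
    obtain ⟨F, t, ht, hto⟩ := isOpen_pi_iff.1 ho N hN
    have : ∀ a : F, ∃ δ > 0, Metric.ball (N a) δ ⊆ t a := fun a =>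
      Metric.isOpen_iff.1 (ht a a.2).1 _ (ht a a.2).2
    choose d hd hdt using this
    obtain ⟨δ, hδ, hδd⟩ : ∃ δ > 0, ∀ a : F, δ ≤ d a := by
      rcases isEmpty_or_nonempty F with hF | hF
      · exact ⟨1, one_pos, fun a => (hF.false a).elim⟩
      · obtain ⟨a, ha⟩ := Finite.exists_min d
        exact ⟨d a, hd a, ha⟩
    obtain ⟨g, hg, hgN⟩ := h F F.finite_toSet δ hδ
    refine ⟨g, hto fun a ha => hdt ⟨a, ha⟩ ?_, hg⟩
    rw [Metric.mem_ball, Real.dist_eq]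
    exact (hgN a ha).trans_le (hδd ⟨a, ha⟩)

/-! ### The compact set of representable seminorms -/

section Seminorms

variable (𝕜 : Type v) [RCLike 𝕜] (X : Type w) [NormedAddCommGroup X] [NormedSpace 𝕜 X]
  {W : Type*} [AddCommGroup W] [Module 𝕜 W] {G : Type*}

/-- The functions on `W` which are pointwise limits of functions `‖T ·‖` with `T : W → X` linear
and which are at most `1` on the family `b`: seminorms that are finitely representable in `X`. -/
def repSeminorms (b : G → W) : Set (W → ℝ) :=
  closure (range fun (T : W →ₗ[𝕜] X) (w : W) => ‖T w‖) ∩ {N | ∀ g, N (b g) ≤ 1}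

variable {𝕜 X} {b : G → W} {N : W → ℝ}

theorem isClosed_repSeminorms : IsClosed (repSeminorms 𝕜 X b) := by
  refine isClosed_closure.inter ?_
  simp only [ofPred_forall]
  exact isClosed_iInter fun g => isClosed_le (continuous_apply _) continuous_const

/-- Each seminorm law involves finitely many coordinates, hence survives pointwise limits. -/
theorem repSeminorms.exists_seminorm (h : N ∈ repSeminorms 𝕜 X b) :
    ∃ p : Seminorm 𝕜 W, ⇑p = N := by
  have hadd : ∀ x y, N (x + y) ≤ N x + N y := by
    intro x y
    have : closure (range fun (T : W →ₗ[𝕜] X) (w : W) => ‖T w‖) ⊆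
        {N | N (x + y) ≤ N x + N y} := by
      refine closure_minimal ?_ (isClosed_le (by fun_prop) (by fun_prop))
      rintro _ ⟨T, rfl⟩
      simpa using norm_add_le (T x) (T y)
    exact this h.1
  have hsmul : ∀ (c : 𝕜) x, N (c • x) = ‖c‖ * N x := by
    intro c x
    have : closure (range fun (T : W →ₗ[𝕜] X) (w : W) => ‖T w‖) ⊆
        {N | N (c • x) = ‖c‖ * N x} := by
      refine closure_minimal ?_ (isClosed_eq (by fun_prop) (by fun_prop))
      rintro _ ⟨T, rfl⟩
      simp [norm_smul]
    exact this h.1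
  exact ⟨Seminorm.of N hadd hsmul, rfl⟩

/-- The bound 1 on a spanning family bounds every coordinate, so Tychonoff's theorem applies. -/
theorem isCompact_repSeminorms (hb : Submodule.span 𝕜 (range b) = ⊤) :
    IsCompact (repSeminorms 𝕜 X b) := by
  have bound : ∀ w : W, ∃ M : ℝ, ∀ N ∈ repSeminorms 𝕜 X b, N w ≤ M := by
    intro w
    have hw : w ∈ Submodule.span 𝕜 (range b) := hb ▸ Submodule.mem_top
    induction hw using Submodule.span_induction with
    | mem x hx =>
      obtain ⟨g, rfl⟩ := hx
      exact ⟨1, fun N hN => hN.2 g⟩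
    | zero =>
      refine ⟨0, fun N hN => ?_⟩
      obtain ⟨p, rfl⟩ := repSeminorms.exists_seminorm hN
      simp
    | add x y _ _ hx hy =>
      obtain ⟨M, hM⟩ := hx
      obtain ⟨M', hM'⟩ := hy
      refine ⟨M + M', fun N hN => ?_⟩
      have h1 := hM N hN
      have h2 := hM' N hN
      obtain ⟨p, rfl⟩ := repSeminorms.exists_seminorm hN
      exact (map_add_le_add p x y).trans (add_le_add h1 h2)
    | smul c x _ hx =>
      obtain ⟨M, hM⟩ := hx
      refine ⟨‖c‖ * M, fun N hN => ?_⟩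
      have h1 := hM N hN
      obtain ⟨p, rfl⟩ := repSeminorms.exists_seminorm hN
      rw [map_smul_eq_mul]
      gcongr
  choose M hM using bound
  refine (isCompact_univ_pi fun w => isCompact_Icc (a := 0) (b := M w)).of_isClosed_subset
    isClosed_repSeminorms fun N hN w _ => ⟨?_, hM w N hN⟩
  obtain ⟨p, rfl⟩ := repSeminorms.exists_seminorm hN
  exact apply_nonneg p w

theorem FinitelyRepresentable.norm_comp_mem_repSeminorms {Z : Type*} [NormedAddCommGroup Z]
    [NormedSpace 𝕜 Z] (h : FinitelyRepresentable 𝕜 Z X) (T : W →ₗ[𝕜] Z)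
    (hT : ∀ g, ‖T (b g)‖ ≤ 1) : (fun w => ‖T w‖) ∈ repSeminorms 𝕜 X b := by
  refine ⟨mem_closure_pi_real_iff.2 fun F hF δ hδ => ?_, hT⟩
  obtain ⟨S, hS⟩ := h.exists_linearMap (hF.image T) (half_pos hδ)
  refine ⟨_, ⟨S ∘ₗ T, rfl⟩, fun a ha => ?_⟩
  exact (hS _ (mem_image_of_mem _ ha)).trans_lt (half_lt_self hδ)

end Seminorms

/-! ### Norm problems and maximal seminorms -/

section Problems

/-- The value of the linear combination coded by a list, the coefficients being taken from a dense
sequence of scalars. -/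
noncomputable def codedSum (𝕜 : Type v) [RCLike 𝕜] {T M : Type*} [AddCommGroup M] [Module 𝕜 M]
    (v : T → M) (l : List (T × ℕ)) : M :=
  (l.map fun x => TopologicalSpace.denseSeq 𝕜 x.2 • v x.1).sum

/-- A finite list of constraints `r ≤ ‖z‖ ≤ s`, for `z` a linear combination of parameters in `G`
and of unknowns indexed by `ℕ`. -/
abbrev NormProblem (G : Type u) : Type u := List (List ((G ⊕ ℕ) × ℕ) × ℚ × ℚ)

/-- The assignment `v` solves the problem `p` with respect to the norm `N`. -/
def NormProblem.Solves (𝕜 : Type v) [RCLike 𝕜] {G : Type u} {W : Type*} [AddCommGroup W]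
    [Module 𝕜 W] (p : NormProblem G) (N : W → ℝ) (v : G ⊕ ℕ → W) : Prop :=
  ∀ c ∈ p, (c.2.1 : ℝ) ≤ N (codedSum 𝕜 v c.1) ∧ N (codedSum 𝕜 v c.1) ≤ c.2.2

/-- A bound for the levels of the parameters of a problem. -/
def NormProblem.level {I : Type u} (p : NormProblem (I × ℕ)) : ℕ :=
  (p.map fun c => (c.1.map fun x => Sum.elim Prod.snd (fun _ => 0) x.1).sum).sum

variable {𝕜 : Type v} [RCLike 𝕜]

theorem map_codedSum {T M M' : Type*} [AddCommGroup M] [Module 𝕜 M] [AddCommGroup M']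
    [Module 𝕜 M'] (f : M →ₗ[𝕜] M') (v : T → M) (l : List (T × ℕ)) :
    f (codedSum 𝕜 v l) = codedSum 𝕜 (f ∘ v) l := by
  simp [codedSum, map_list_sum, Function.comp_def]

theorem codedSum_congr {T M : Type*} [AddCommGroup M] [Module 𝕜 M] {v v' : T → M}
    {l : List (T × ℕ)} (h : ∀ x ∈ l, v x.1 = v' x.1) : codedSum 𝕜 v l = codedSum 𝕜 v' l := by
  unfold codedSum
  rw [List.map_congr_left fun x hx => by rw [h x hx]]

theorem codedSum_mem {T M : Type*} [AddCommGroup M] [Module 𝕜 M] {v : T → M} {S : Submodule 𝕜 M}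
    {l : List (T × ℕ)} (h : ∀ x ∈ l, v x.1 ∈ S) : codedSum 𝕜 v l ∈ S := by
  refine list_sum_mem fun y hy => ?_
  obtain ⟨x, hx, rfl⟩ := List.mem_map.1 hy
  exact S.smul_mem _ (h x hx)

theorem NormProblem.le_level {I : Type u} {p : NormProblem (I × ℕ)}
    {c : List (((I × ℕ) ⊕ ℕ) × ℕ) × ℚ × ℚ} (hc : c ∈ p) {g : I × ℕ} {m : ℕ}
    (hg : (Sum.inl g, m) ∈ c.1) : g.2 ≤ p.level := by
  have h1 : g.2 ≤ (c.1.map fun x => Sum.elim Prod.snd (fun _ => 0) x.1).sum :=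
    List.le_sum_of_mem (List.mem_map.2 ⟨_, hg, rfl⟩)
  exact h1.trans (List.le_sum_of_mem (List.mem_map.2 ⟨_, hc, rfl⟩))

/-- The assignment which sends the parameters to the family `b` and the unknowns of `p` to members
of the family reserved for `p`. -/
def NormProblem.assignment {I : Type u} {W : Type*} (e : NormProblem (I × ℕ) × ℕ → I)
    (b : I × ℕ → W) (p : NormProblem (I × ℕ)) : (I × ℕ) ⊕ ℕ → W :=
  Sum.elim b fun j => b (e (p, j), p.level + 1)

theorem isClosed_solves {G : Type u} {W : Type*} [AddCommGroup W] [Module 𝕜 W]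
    (p : NormProblem G) (v : G ⊕ ℕ → W) : IsClosed {N : W → ℝ | p.Solves 𝕜 N v} := by
  simp only [NormProblem.Solves, ofPred_forall]
  exact isClosed_iInter fun c => isClosed_iInter fun _ =>
    (isClosed_le continuous_const (continuous_apply _)).inter
      (isClosed_le (continuous_apply _) continuous_const)

variable {X : Type w} [NormedAddCommGroup X] [NormedSpace 𝕜 X] {I : Type u} {W : Type*}
  [AddCommGroup W] [Module 𝕜 W]

variable (𝕜) in
/-- The span of the members of level at most `n` of a family. -/
def levelSpan (b : I × ℕ → W) (n : ℕ) : Submodule 𝕜 W := Submodule.span 𝕜 (b '' {g | g.2 ≤ n})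

theorem levelSpan_mono (b : I × ℕ → W) {m n : ℕ} (h : m ≤ n) :
    levelSpan 𝕜 b m ≤ levelSpan 𝕜 b n :=
  Submodule.span_mono (image_mono fun _ hg => le_trans hg h)

/-- Only vectors of level at most `p.level + 1` occur in `p`, so later stages of the construction
cannot change whether it is solved. -/
theorem NormProblem.solves_assignment_congr {e : NormProblem (I × ℕ) × ℕ → I} {b : I × ℕ → W}
    {p : NormProblem (I × ℕ)} {N N' : W → ℝ}
    (h : ∀ w ∈ levelSpan 𝕜 b (p.level + 1), N' w = N w) (hs : p.Solves 𝕜 N (p.assignment e b)) :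
    p.Solves 𝕜 N' (p.assignment e b) := by
  intro c hc
  rw [h _ (codedSum_mem ?_)]
  · exact hs c hc
  · rintro ⟨g | j, m⟩ hg
    · exact Submodule.subset_span
        (mem_image_of_mem _ ((NormProblem.le_level hc hg).trans (Nat.le_succ _)))
    · exact Submodule.subset_span (mem_image_of_mem _ (le_refl (p.level + 1)))

/-- There is a seminorm solving, at each level, a maximal set of problems. -/
theorem exists_maximal_repSeminorm (e : NormProblem (I × ℕ) × ℕ → I) (b : I × ℕ → W)
    (hb : Submodule.span 𝕜 (range b) = ⊤) {N₀ : W → ℝ} (hN₀ : N₀ ∈ repSeminorms 𝕜 X b) :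
    ∃ N ∈ repSeminorms 𝕜 X b, (∀ w ∈ levelSpan 𝕜 b 0, N w = N₀ w) ∧
      ∀ N' ∈ repSeminorms 𝕜 X b, ∀ n : ℕ, (∀ w ∈ levelSpan 𝕜 b n, N' w = N w) →
        (∀ p : NormProblem (I × ℕ), p.level = n → p.Solves 𝕜 N (p.assignment e b) →
          p.Solves 𝕜 N' (p.assignment e b)) →
        ∀ p : NormProblem (I × ℕ), p.level = n → p.Solves 𝕜 N' (p.assignment e b) →
          p.Solves 𝕜 N (p.assignment e b) := by
  have hK := isCompact_repSeminorms (𝕜 := 𝕜) (X := X) hb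
  have agree_closed : ∀ (n : ℕ) (M : W → ℝ),
      IsClosed {N : W → ℝ | ∀ w ∈ levelSpan 𝕜 b n, N w = M w} := by
    intro n M
    simp only [ofPred_forall]
    exact isClosed_iInter fun w => isClosed_iInter fun _ =>
      isClosed_eq (continuous_apply _) continuous_const
  have step : ∀ (n : ℕ) (M : repSeminorms 𝕜 X b), ∃ N : repSeminorms 𝕜 X b,
      (∀ w ∈ levelSpan 𝕜 b n, N.1 w = M.1 w) ∧
      ∀ N' ∈ repSeminorms 𝕜 X b, (∀ w ∈ levelSpan 𝕜 b n, N' w = M.1 w) →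
        (∀ p : NormProblem (I × ℕ), p.level = n → p.Solves 𝕜 N.1 (p.assignment e b) →
          p.Solves 𝕜 N' (p.assignment e b)) →
        ∀ p : NormProblem (I × ℕ), p.level = n → p.Solves 𝕜 N' (p.assignment e b) →
          p.Solves 𝕜 N.1 (p.assignment e b) := by
    intro n M
    obtain ⟨N, hN, hmax⟩ := (hK.inter_right (agree_closed n M.1)).exists_maximal_of_isClosed
      ⟨M.1, M.2, fun _ _ => rfl⟩
      (fun p : {p : NormProblem (I × ℕ) // p.level = n} =>
        {N : W → ℝ | p.1.Solves 𝕜 N (p.1.assignment e b)}) fun p => isClosed_solves _ _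
    exact ⟨⟨N, hN.1⟩, hN.2, fun N' hN' hag hs p hp hps =>
      hmax N' ⟨hN', hag⟩ (fun q hq => hs q.1 q.2 hq) ⟨p, hp⟩ hps⟩
  choose f hf hfmax using step
  let s : ℕ → repSeminorms 𝕜 X b := fun n => Nat.rec ⟨N₀, hN₀⟩ (fun n M => f n M) n
  have s_succ : ∀ n, s (n + 1) = f n (s n) := fun n => rfl
  -- Stage `n + 1` agrees with stage `n` up to level `n`, so these compact sets decrease; a common
  -- point is a limit of all stages.
  obtain ⟨N, hN⟩ := IsCompact.nonempty_iInter_of_sequence_nonempty_isCompact_isClosed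
    (fun n => repSeminorms 𝕜 X b ∩ {N : W → ℝ | ∀ w ∈ levelSpan 𝕜 b n, N w = (s n).1 w})
    (fun n N hN => ⟨hN.1, fun w hw => by
      rw [hN.2 w (levelSpan_mono b n.le_succ hw), s_succ, hf n _ w hw]⟩)
    (fun n => ⟨(s n).1, (s n).2, fun _ _ => rfl⟩)
    (hK.inter_right (agree_closed _ _))
    (fun n => isClosed_repSeminorms.inter (agree_closed _ _))
  have hNs : ∀ n, ∀ w ∈ levelSpan 𝕜 b n, N w = (s n).1 w := fun n => (mem_iInter.1 hN n).2
  refine ⟨N, (mem_iInter.1 hN 0).1, hNs 0, ?_⟩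
  rintro N' hN' n hag hs p rfl hp
  -- On level `n + 1` the limit equals stage `n + 1`, so that stage's maximality for problems of
  -- level `n` passes to it.
  refine NormProblem.solves_assignment_congr (hNs _) ?_
  rw [s_succ]
  refine hfmax _ _ N' hN' (fun w hw => (hag w hw).trans (hNs _ w hw)) ?_ p rfl hp
  intro q hq hqs
  refine hs q hq (NormProblem.solves_assignment_congr (fun w hw => ?_) hqs)
  rw [hq] at hw
  rw [hNs _ w hw, s_succ]

/-- In such a maximal seminorm, the problems solvable in an extension are solved. -/
theorem NormProblem.solves_of_extension {e : NormProblem (I × ℕ) × ℕ → I}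
    (he : Function.Injective e) (b : Module.Basis (I × ℕ) 𝕜 W) {N : W → ℝ}
    (hN : N ∈ repSeminorms 𝕜 X b)
    (hmax : ∀ N' ∈ repSeminorms 𝕜 X b, ∀ n : ℕ, (∀ w ∈ levelSpan 𝕜 b n, N' w = N w) →
        (∀ p : NormProblem (I × ℕ), p.level = n → p.Solves 𝕜 N (p.assignment e b) →
          p.Solves 𝕜 N' (p.assignment e b)) →
        ∀ p : NormProblem (I × ℕ), p.level = n → p.Solves 𝕜 N' (p.assignment e b) →
          p.Solves 𝕜 N (p.assignment e b))
    {Z : Type*} [NormedAddCommGroup Z] [NormedSpace 𝕜 Z] (hZ : FinitelyRepresentable 𝕜 Z X)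
    (i : W →ₗ[𝕜] Z) (hi : ∀ w, ‖i w‖ = N w) (p : NormProblem (I × ℕ)) (z : ℕ → Z)
    (hz : ∀ j, ‖z j‖ ≤ 1) (hp : p.Solves 𝕜 norm (Sum.elim (i ∘ b) z)) :
    p.Solves 𝕜 N (p.assignment e b) := by
  classical
  -- Only the vectors reserved for `p` are moved. They lie above level `p.level`, and injectivity of
  -- `e` keeps them apart from those reserved for other problems.
  let t : I × ℕ → Z := fun g =>
    if h : ∃ j, g = (e (p, j), p.level + 1) then z h.choose else i (b g)
  have t_low : ∀ g, g.2 ≤ p.level → t g = i (b g) := by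
    intro g hg
    refine dif_neg ?_
    rintro ⟨j, rfl⟩
    exact Nat.not_succ_le_self _ hg
  have t_sol : ∀ j, t (e (p, j), p.level + 1) = z j := by
    intro j
    have h : ∃ j', (e (p, j), p.level + 1) = (e (p, j'), p.level + 1) := ⟨j, rfl⟩
    have : h.choose = j := by
      have := congrArg Prod.fst h.choose_spec
      exact (congrArg Prod.snd (he this)).symm
    simp only [t, dif_pos h, this]
  have t_other : ∀ q, q ≠ p → ∀ j m, t (e (q, j), m) = i (b (e (q, j), m)) := by
    intro q hq j m
    refine dif_neg ?_
    rintro ⟨j', h⟩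
    exact hq (congrArg Prod.fst (he (congrArg Prod.fst h)))
  let T : W →ₗ[𝕜] Z := b.constr 𝕜 t
  have hTb : ∀ g, T (b g) = t g := fun g => b.constr_basis 𝕜 t g
  have hT1 : ∀ g, ‖T (b g)‖ ≤ 1 := by
    intro g
    rw [hTb]
    by_cases h : ∃ j, g = (e (p, j), p.level + 1)
    · simp only [t, dif_pos h]; exact hz _
    · simp only [t, dif_neg h]; rw [hi]; exact hN.2 g
  have hTi : ∀ w ∈ levelSpan 𝕜 b p.level, T w = i w := by
    intro w hw
    refine LinearMap.eqOn_span (f := T) (g := i) ?_ hw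
    rintro _ ⟨g, hg, rfl⟩
    rw [hTb, t_low g hg]
  have hTp : p.Solves 𝕜 (fun w => ‖T w‖) (p.assignment e b) := by
    intro c hc
    have : T (codedSum 𝕜 (p.assignment e b) c.1) = codedSum 𝕜 (Sum.elim (i ∘ b) z) c.1 := by
      rw [map_codedSum]
      refine codedSum_congr ?_
      rintro ⟨g | j, m⟩ hg
      · exact (hTb g).trans (t_low g (NormProblem.le_level hc hg))
      · exact (hTb _).trans (t_sol j)
    simp only [this]
    exact hp c hc
  refine hmax _ (hZ.norm_comp_mem_repSeminorms T hT1) p.level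
    (fun w hw => by rw [hTi w hw, hi]) (fun q hq hqs => ?_) p rfl hTp
  rcases eq_or_ne q p with rfl | hqp
  · exact hTp
  intro c hc
  have : ‖T (codedSum 𝕜 (q.assignment e b) c.1)‖ = N (codedSum 𝕜 (q.assignment e b) c.1) := by
    rw [← hi, map_codedSum, map_codedSum]
    congr 1
    refine codedSum_congr ?_
    rintro ⟨g | j, m⟩ hg
    · exact (hTb g).trans (t_low g ((NormProblem.le_level hc hg).trans hq.le))
    · exact (hTb _).trans (t_other q hqp j _)
  simp only [this]
  exact hqs c hc

end Problems

/-! ### Completion, coding and reflecting subspaces -/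

/-- The completion of a vector space with respect to a seminorm. -/
theorem Seminorm.exists_completion {𝕜 : Type v} [RCLike 𝕜] {W : Type u} [AddCommGroup W]
    [Module 𝕜 W] (p : Seminorm 𝕜 W) :
    ∃ (E : Type u) (_ : NormedAddCommGroup E) (_ : NormedSpace 𝕜 E) (_ : CompleteSpace E)
      (φ : W →ₗ[𝕜] E), DenseRange φ ∧ ∀ w, ‖φ w‖ = p w := by
  let : Norm W := ⟨p⟩
  have core : SeminormedSpace.Core 𝕜 W :=
    ⟨fun w => apply_nonneg p w, fun c w => map_smul_eq_mul p c w, fun x y => map_add_le_add p x y⟩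
  let : SeminormedAddCommGroup W := SeminormedAddCommGroup.ofCore core
  let : NormedSpace 𝕜 W := { norm_smul_le := fun c w => (map_smul_eq_mul p c w).le }
  exact ⟨UniformSpace.Completion W, inferInstance, inferInstance, inferInstance,
    (UniformSpace.Completion.toComplₗᵢ (𝕜 := 𝕜) (E := W)).toLinearMap,
    UniformSpace.Completion.denseRange_coe, fun w => UniformSpace.Completion.norm_coe w⟩

section

variable {𝕜 : Type v} [RCLike 𝕜]

/-- Finite linear combinations are approximated by coded ones, uniformly on bounded families. -/
theorem exists_codedSum_near {T M : Type*} [NormedAddCommGroup M] [NormedSpace 𝕜 M] (β : T → ℝ)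
    (w : T →₀ 𝕜) {δ : ℝ} (hδ : 0 < δ) :
    ∃ l : List (T × ℕ), ∀ v : T → M, (∀ t, ‖v t‖ ≤ β t) →
      ‖Finsupp.linearCombination 𝕜 v w - codedSum 𝕜 v l‖ ≤ δ := by
  induction w using Finsupp.induction_linear generalizing δ with
  | zero => exact ⟨[], fun v _ => by simpa [codedSum] using hδ.le⟩
  | add x y hx hy =>
    obtain ⟨l, hl⟩ := hx (half_pos hδ)
    obtain ⟨l', hl'⟩ := hy (half_pos hδ)
    refine ⟨l ++ l', fun v hv => ?_⟩
    have : codedSum 𝕜 v (l ++ l') = codedSum 𝕜 v l + codedSum 𝕜 v l' := by simp [codedSum]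
    rw [this, map_add, add_sub_add_comm]
    exact (norm_add_le_of_le (hl v hv) (hl' v hv)).trans (add_halves δ).le
  | single t a =>
    obtain ⟨n, hn⟩ := (TopologicalSpace.denseRange_denseSeq 𝕜).exists_dist_lt a
      (show 0 < δ / (|β t| + 1) by positivity)
    refine ⟨[(t, n)], fun v hv => ?_⟩
    simp only [Finsupp.linearCombination_single, codedSum, List.map_cons, List.map_nil,
      List.sum_cons, List.sum_nil, add_zero]
    rw [← sub_smul, norm_smul, ← dist_eq_norm]
    calc _ ≤ δ / (|β t| + 1) * |β t| := by
          gcongr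
          exact (hv t).trans (le_abs_self _)
      _ ≤ δ := by
          rw [div_mul_eq_mul_div, div_le_iff₀ (by positivity)]
          nlinarith

/-- The code must not depend on `y`: the same one is evaluated at the given vectors of `Z` and at
the solution found in `E`. -/
theorem exists_codedSum_near_of_dense {G E Z : Type*} [NormedAddCommGroup E] [NormedSpace 𝕜 E]
    [NormedAddCommGroup Z] [NormedSpace 𝕜 Z] {c : G → E} (hc : ∀ g, ‖c g‖ ≤ 1)
    (hd : Dense (Submodule.span 𝕜 (range c) : Set E)) (i : E →ₗᵢ[𝕜] Z) {k : ℕ} (e : E)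
    (d : Fin k → 𝕜) {δ : ℝ} (hδ : 0 < δ) :
    ∃ l : List ((G ⊕ ℕ) × ℕ), ∀ y : ℕ → Z, (∀ j, ‖y j‖ ≤ 1) →
      ‖i e + ∑ j, d j • y j - codedSum 𝕜 (Sum.elim (i ∘ c) y) l‖ ≤ δ := by
  obtain ⟨e', he', hee'⟩ := hd.exists_dist_lt e (half_pos hδ)
  obtain ⟨w₀, rfl⟩ := Finsupp.mem_span_range_iff_exists_finsupp.1 he'
  obtain ⟨l, hl⟩ := exists_codedSum_near (𝕜 := 𝕜) (M := Z) (fun _ : G ⊕ ℕ => 1)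
    (w₀.mapDomain Sum.inl + ∑ j : Fin k, Finsupp.single (Sum.inr (j : ℕ)) (d j)) (half_pos hδ)
  refine ⟨l, fun y hy => ?_⟩
  have h1 := hl (Sum.elim (i ∘ c) y) (by
    rintro (g | j)
    · simpa using hc g
    · exact hy j)
  have h2 : Finsupp.linearCombination 𝕜 (Sum.elim (i ∘ c) y)
      (w₀.mapDomain Sum.inl + ∑ j : Fin k, Finsupp.single (Sum.inr (j : ℕ)) (d j)) =
      i (w₀.sum fun g a => a • c g) + ∑ j, d j • y j := by
    rw [map_add, map_sum, Finsupp.linearCombination_mapDomain]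
    simp only [Finsupp.linearCombination_single, Sum.elim_inr, Sum.elim_comp_inl]
    rw [Finsupp.linearCombination_apply, map_finsuppSum]
    simp
  rw [h2] at h1
  have h3 : ‖i e - i (w₀.sum fun g a => a • c g)‖ ≤ δ / 2 := by
    rw [← map_sub, i.norm_map, ← dist_eq_norm]
    exact hee'.le
  calc _ = ‖(i e - i (w₀.sum fun g a => a • c g)) +
        (i (w₀.sum fun g a => a • c g) + ∑ j, d j • y j
          - codedSum 𝕜 (Sum.elim (i ∘ c) y) l)‖ := by congr 1; abel
    _ ≤ δ / 2 + δ / 2 := norm_add_le_of_le h3 h1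
    _ = δ := add_halves δ

/-- If all norm problems with parameters spanning `E` that have a solution in `Z` have one in `E`,
then `E` is reflecting in `Z`. -/
theorem isReflecting_range_of_solves {G : Type u} {E : Type*} {Z : Type*} [NormedAddCommGroup E]
    [NormedSpace 𝕜 E] [NormedAddCommGroup Z] [NormedSpace 𝕜 Z] {c : G → E} (hc : ∀ g, ‖c g‖ ≤ 1)
    (hd : Dense (Submodule.span 𝕜 (range c) : Set E)) (i : E →ₗᵢ[𝕜] Z)
    (h : ∀ (p : NormProblem G) (z : ℕ → Z), (∀ j, ‖z j‖ ≤ 1) →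
      p.Solves 𝕜 norm (Sum.elim (i ∘ c) z) →
      ∃ x : ℕ → E, (∀ j, ‖x j‖ ≤ 1) ∧ p.Solves 𝕜 norm (Sum.elim c x)) :
    IsReflecting 𝕜 (LinearMap.range i.toLinearMap) := by
  classical
  intro ε hε A hA
  obtain ⟨η, hη, hη1, hηε⟩ := exists_distortion_lt hε
  obtain ⟨F, hF, δ, hδ, key⟩ := exists_finite_almost_isometry (𝕜 := 𝕜) A hη
  let A₀ : Submodule 𝕜 A := (LinearMap.range i.toLinearMap).comap A.subtype
  -- `π` projects `A` onto its intersection with the image of `E`; the embedding will fix that part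
  -- and move only the complement `ker π`.
  obtain ⟨π, hπ⟩ := LinearMap.exists_leftInverse_of_injective A₀.subtype
    (LinearMap.ker_eq_bot.2 A₀.subtype_injective)
  have hπ' : ∀ a : A₀, π a = a := fun a => LinearMap.congr_fun hπ a
  let Q : A →ₗ[𝕜] LinearMap.ker π := (LinearMap.id - A₀.subtype ∘ₗ π).codRestrict _ fun f => by
    simp [hπ']
  have hQ : ∀ f, (Q f : A) = f - π f := fun f => rfl
  let b := Module.finBasis 𝕜 (LinearMap.ker π)
  -- Unknowns must lie in the unit ball, so the basis of the complement is scaled down.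
  let t : ℝ := (1 + ∑ j, ‖b j‖)⁻¹
  have ht : 0 < t := by positivity
  have htb : ∀ j, t * ‖b j‖ ≤ 1 := by
    intro j
    have : ‖b j‖ ≤ ∑ j, ‖b j‖ :=
      Finset.single_le_sum (f := fun j => ‖b j‖) (fun _ _ => norm_nonneg _) (Finset.mem_univ j)
    rw [inv_mul_le_iff₀ (by positivity)]
    linarith
  have htk : (t : 𝕜) ≠ 0 := by exact_mod_cast ht.ne'
  let z : ℕ → Z := fun j => if hj : j < _ then (t : 𝕜) • ((b ⟨j, hj⟩ : A) : Z) else 0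
  have hz : ∀ j : Fin _, z j = (t : 𝕜) • ((b j : A) : Z) := fun j => dif_pos j.2
  have hz1 : ∀ j, ‖z j‖ ≤ 1 := by
    intro j
    by_cases hj : j < Module.finrank 𝕜 (LinearMap.ker π)
    · simp only [z, dif_pos hj]
      rw [norm_smul, RCLike.norm_ofReal, abs_of_pos ht]
      exact htb _
    · simp [z, dif_neg hj]
  have hπi : ∀ f : A, ∃ e : E, i e = ((π f : A) : Z) := fun f => (π f).2
  choose e he using hπi
  have code := fun f : A => exists_codedSum_near_of_dense (𝕜 := 𝕜) hc hd i (e f)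
    (fun j => (t : 𝕜)⁻¹ * b.repr (Q f) j) (show 0 < δ / 3 by positivity)
  choose l hl using code
  let S : A → (ℕ → Z) → Z := fun f y => codedSum 𝕜 (Sum.elim (i ∘ c) y) (l f)
  -- With margins `δ / 6` on both sides, values in the interval from `r f` to `s f` differ by less
  -- than `δ / 3`.
  have low : ∀ f : A, ∃ q : ℚ, ‖S f z‖ - δ / 6 < q ∧ (q : ℝ) < ‖S f z‖ :=
    fun f => exists_rat_btwn (by linarith)
  have up : ∀ f : A, ∃ q : ℚ, ‖S f z‖ < q ∧ (q : ℝ) < ‖S f z‖ + δ / 6 :=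
    fun f => exists_rat_btwn (by linarith)
  choose r hr hr' using low
  choose s hs hs' using up
  obtain ⟨x, hx1, hx⟩ := h (hF.toFinset.toList.map fun f => (l f, r f, s f)) z hz1 (by
    intro k hk
    obtain ⟨f, -, rfl⟩ := List.mem_map.1 hk
    exact ⟨(hr' f).le, (hs f).le⟩)
  let u : A →ₗ[𝕜] Z := A.subtype ∘ₗ A₀.subtype ∘ₗ π +
    b.constr 𝕜 (fun j => (t : 𝕜)⁻¹ • i (x j)) ∘ₗ Q
  have hu : ∀ f, u f = i (e f) + ∑ j, ((t : 𝕜)⁻¹ * b.repr (Q f) j) • i (x j) := by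
    intro f
    simp only [u, LinearMap.add_apply, LinearMap.comp_apply, Submodule.subtype_apply, he,
      Module.Basis.constr_apply_fintype, Module.Basis.equivFun_apply]
    congr 1
    exact Finset.sum_congr rfl fun j _ => by rw [smul_smul, mul_comm]
  have hid : ∀ f : A, (f : Z) = i (e f) + ∑ j : Fin _, ((t : 𝕜)⁻¹ * b.repr (Q f) j) • z j := by
    intro f
    have h1 : ∑ j, b.repr (Q f) j • ((b j : A) : Z) = ((Q f : A) : Z) := by
      have := congrArg (A.subtype ∘ₗ (LinearMap.ker π).subtype) (b.sum_repr (Q f))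
      rw [map_sum] at this
      simp only [map_smul] at this
      exact this
    have h2 : ∀ j, ((t : 𝕜)⁻¹ * b.repr (Q f) j) • z j = b.repr (Q f) j • ((b j : A) : Z) := by
      intro j
      rw [hz, smul_smul]
      congr 1
      field_simp
    rw [Finset.sum_congr rfl fun j _ => h2 j, h1, he, hQ]
    simp
  have hSx : ∀ f ∈ F, |‖S f fun j => i (x j)‖ - ‖S f z‖| ≤ δ / 3 := by
    intro f hf
    have h1 := hx (l f, r f, s f) (List.mem_map.2 ⟨f, by simpa using hf, rfl⟩)
    have h2 : ‖codedSum 𝕜 (Sum.elim c x) (l f)‖ = ‖S f fun j => i (x j)‖ := by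
      rw [← i.norm_map, ← LinearIsometry.coe_toLinearMap, map_codedSum]
      congr 2
      funext j
      rcases j with g | j <;> rfl
    rw [h2] at h1
    rw [abs_le]
    constructor <;> linarith [h1.1, h1.2, hr f, hr' f, hs f, hs' f]
  -- Three errors of `δ / 3`: coding at the solution, passing from `z` to the solution, and coding
  -- at `z`.
  have hux : ∀ f ∈ F, |‖u f‖ - ‖f‖| ≤ δ := by
    intro f hf
    have h1 := abs_le.1 ((abs_norm_sub_norm_le _ _).trans
      (hl f (fun j => i (x j)) fun j => by simpa using hx1 j))
    have h2 := abs_le.1 ((abs_norm_sub_norm_le _ _).trans (hl f z hz1))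
    have h3 := abs_le.1 (hSx f hf)
    rw [← hu] at h1
    rw [← hid] at h2
    have h4 : ‖f‖ = ‖(f : Z)‖ := rfl
    rw [abs_le, h4]
    simp only [S] at h3
    constructor <;> linarith [h1.1, h1.2, h2.1, h2.2, h3.1, h3.2]
  obtain ⟨U, hU, hUu⟩ := exists_equiv_range_of_almost_isometry hη hη1 hηε u (key Z u hux)
  refine ⟨_, ?_, U, hU, fun a ha => ?_⟩
  · rintro _ ⟨f, rfl⟩
    rw [hu]
    refine Submodule.add_mem _ ⟨_, rfl⟩ (Submodule.sum_mem _ fun j _ => ?_)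
    exact Submodule.smul_mem _ _ ⟨_, rfl⟩
  · have h1 : ((π a : A₀) : A) = a := congrArg Subtype.val (hπ' ⟨a, ha⟩)
    have h2 : Q a = 0 := Subtype.ext (by rw [hQ, h1]; simp)
    rw [hUu, hu, he, h1, h2]
    simp

end

/-! ### Density and cardinality -/

section

variable {𝕜 : Type v} [RCLike 𝕜]

theorem infinite_of_dense_span {E : Type*} [NormedAddCommGroup E] [NormedSpace 𝕜 E]
    (hE : ¬ FiniteDimensional 𝕜 E) {S : Set E} (hS : Dense (Submodule.span 𝕜 S : Set E)) :
    Infinite S := by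
  by_contra hfin
  have hSf : S.Finite := not_infinite.1 fun h => hfin h.to_subtype
  have : FiniteDimensional 𝕜 (Submodule.span 𝕜 S) := FiniteDimensional.span_of_finite 𝕜 hSf
  have htop : Submodule.span 𝕜 S = ⊤ :=
    SetLike.coe_injective ((Submodule.closed_of_finiteDimensional _).closure_eq.symm.trans
      hS.closure_eq)
  rw [htop] at this
  exact hE (Module.finite_def.2 (Module.Finite.iff_fg.1 this))

theorem exists_codedSum_dist_lt {E : Type*} [NormedAddCommGroup E] [NormedSpace 𝕜 E] {S : Set E}
    (hS : Dense (Submodule.span 𝕜 S : Set E)) (x : E) {δ : ℝ} (hδ : 0 < δ) :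
    ∃ l : List (S × ℕ), dist x (codedSum 𝕜 Subtype.val l) < δ := by
  obtain ⟨e, he, hxe⟩ := hS.exists_dist_lt x (half_pos hδ)
  have he' : e ∈ Submodule.span 𝕜 (range (Subtype.val : S → E)) := by
    rwa [Subtype.range_coe]
  obtain ⟨w, rfl⟩ := Finsupp.mem_span_range_iff_exists_finsupp.1 he'
  obtain ⟨l, hl⟩ := exists_codedSum_near (𝕜 := 𝕜) (M := E) (fun s : S => ‖(s : E)‖) w
    (show 0 < δ / 3 by positivity)
  have h1 := hl Subtype.val fun _ => le_rfl
  rw [← dist_eq_norm, Finsupp.linearCombination_apply] at h1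
  have h2 := dist_triangle x (w.sum fun i a => a • (i : E)) (codedSum 𝕜 Subtype.val l)
  exact ⟨l, by linarith⟩

theorem exists_dense_span_mk_eq_banachDim (Y : Type u) [NormedAddCommGroup Y] [NormedSpace 𝕜 Y] :
    ∃ S : Set Y, #S = banachDim 𝕜 Y ∧ Dense (Submodule.span 𝕜 S : Set Y) :=
  csInf_mem (s := {c : Cardinal.{u} | ∃ A : Set Y, #A = c ∧
    Dense (Submodule.span 𝕜 A : Set Y)}) ⟨_, univ, rfl, by simp⟩

theorem banachDim_le_mk {Y : Type u} [NormedAddCommGroup Y] [NormedSpace 𝕜 Y] {S : Set Y}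
    (hS : Dense (Submodule.span 𝕜 S : Set Y)) : banachDim 𝕜 Y ≤ #S :=
  csInf_le' ⟨S, rfl, hS⟩

/-- The dimension of an infinite-dimensional space is at most that of any larger space. -/
theorem banachDim_le_of_isometry {Y E : Type u} [NormedAddCommGroup Y] [NormedSpace 𝕜 Y]
    [NormedAddCommGroup E] [NormedSpace 𝕜 E] (hY : ¬ FiniteDimensional 𝕜 Y) (j : Y →ₗᵢ[𝕜] E) :
    banachDim 𝕜 Y ≤ banachDim 𝕜 E := by
  classical
  obtain ⟨S, hSc, hS⟩ := exists_dense_span_mk_eq_banachDim (𝕜 := 𝕜) E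
  have hE : ¬ FiniteDimensional 𝕜 E := fun _ =>
    hY (FiniteDimensional.of_injective j.toLinearMap j.injective)
  have := infinite_of_dense_span hE hS
  -- Coded sums need not lie in the image of `Y`, so a nearby image point is chosen if there is one;
  -- two such points near the same sum are near each other. The default 0 plays no role.
  let f : List (S × ℕ) × ℕ → Y := fun q =>
    if h : ∃ y, dist (j y) (codedSum 𝕜 Subtype.val q.1) < 1 / (q.2 + 1 : ℝ) then h.choose else 0
  have hf : DenseRange f := by
    refine Metric.denseRange_iff.2 fun y r hr => ?_
    obtain ⟨n, hn⟩ := exists_nat_one_div_lt (half_pos hr)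
    obtain ⟨l, hl⟩ := exists_codedSum_dist_lt hS (j y) (show (0 : ℝ) < 1 / (n + 1) by positivity)
    have h : ∃ y, dist (j y) (codedSum 𝕜 Subtype.val l) < 1 / (n + 1 : ℝ) := ⟨y, hl⟩
    have h1 : f (l, n) = h.choose := dif_pos h
    refine ⟨(l, n), ?_⟩
    rw [h1, ← j.dist_map]
    have h2 := dist_triangle_right (j y) (j h.choose) (codedSum 𝕜 Subtype.val l)
    linarith [h.choose_spec]
  calc banachDim 𝕜 Y ≤ #(range f) := banachDim_le_mk (hf.mono Submodule.subset_span)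
    _ ≤ #(List (S × ℕ) × ℕ) := mk_range_le
    _ = banachDim 𝕜 E := by
      rw [mk_prod, mk_list_eq_mk, mk_prod, ← hSc]
      simp

/-- This leaves room in `I` to reserve separate vectors for all unknowns of all problems. -/
theorem mk_normProblem_prod_nat (I : Type u) [Infinite I] : #(NormProblem (I × ℕ) × ℕ) = #I := by
  have h1 : ℵ₀ ≤ #I := aleph0_le_mk I
  simp [NormProblem, mk_list_eq_mk, h1, add_eq_left h1 h1]

end

theorem Submodule.span_range_inv_norm_smul {𝕜 : Type v} [RCLike 𝕜] {Y : Type u}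
    [NormedAddCommGroup Y] [NormedSpace 𝕜 Y] (S : Set Y) :
    Submodule.span 𝕜 S ≤ Submodule.span 𝕜 (range fun s : S =>
      ((‖(s : Y)‖⁻¹ : ℝ) : 𝕜) • (s : Y)) := by
  refine Submodule.span_le.2 fun s hs => ?_
  rcases eq_or_ne s 0 with rfl | h0
  · exact Submodule.zero_mem _
  have h1 := Submodule.smul_mem _ ((‖s‖ : ℝ) : 𝕜) (Submodule.subset_span (R := 𝕜)
    (mem_range_self (f := fun s : S => ((‖(s : Y)‖⁻¹ : ℝ) : 𝕜) • (s : Y)) ⟨s, hs⟩))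
  rwa [smul_smul, ← RCLike.ofReal_mul, mul_inv_cancel₀ (norm_ne_zero_iff.2 h0), RCLike.ofReal_one,
    one_smul] at h1

/-! ### Construction of the extension -/

/-- Free modules exist in any universe into which the scalars and the generators fit. -/
theorem exists_module_basis (𝕜 : Type v) [RCLike 𝕜] [Small.{u} 𝕜] (G : Type u) :
    ∃ (W : Type u) (_ : AddCommGroup W) (_ : Module 𝕜 W), Nonempty (Module.Basis G 𝕜 W) := by
  have : Small.{u} (G →₀ 𝕜) := small_of_injective (DFunLike.coe_injective (F := G →₀ 𝕜))
  exact ⟨Shrink.{u} (G →₀ 𝕜), inferInstance, inferInstance, ⟨.ofRepr (Shrink.linearEquiv 𝕜 _)⟩⟩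

/-- Every member of `X^f` has an existentially closed extension of the same dimension. -/
theorem exists_existentiallyClosed_extension {𝕜 : Type v} [RCLike 𝕜] {X Y : Type u}
    [NormedAddCommGroup X] [NormedSpace 𝕜 X] [NormedAddCommGroup Y] [NormedSpace 𝕜 Y]
    [CompleteSpace Y] (hX : ¬ FiniteDimensional 𝕜 X) (hXY : FinitelyEquivalent 𝕜 X Y) :
    ∃ (E : Type u) (_ : NormedAddCommGroup E) (_ : NormedSpace 𝕜 E) (_ : CompleteSpace E),
      IsExistentiallyClosed 𝕜 X E ∧ Nonempty (Y →ₗᵢ[𝕜] E) ∧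
        banachDim 𝕜 E = banachDim 𝕜 Y := by
  have hY := hXY.1.not_finiteDimensional hX
  -- The multiples of a nonzero vector embed the scalars into `Y`.
  have : Small.{u} 𝕜 := by
    have : Nontrivial Y := by
      by_contra h
      rw [not_nontrivial_iff_subsingleton] at h
      exact hY inferInstance
    obtain ⟨y, hy⟩ := exists_ne (0 : Y)
    exact small_of_injective (smul_left_injective 𝕜 hy)
  obtain ⟨I, hIc, hI⟩ := exists_dense_span_mk_eq_banachDim (𝕜 := 𝕜) Y
  have := infinite_of_dense_span hY hI
  let a : I → Y := fun s => ((‖(s : Y)‖⁻¹ : ℝ) : 𝕜) • (s : Y)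
  have ha1 : ∀ s, ‖a s‖ ≤ 1 := fun s => by
    simp only [a]
    rw [norm_smul, RCLike.norm_ofReal, abs_of_nonneg (by positivity)]
    exact inv_mul_le_one
  have had : Dense (Submodule.span 𝕜 (range a) : Set Y) :=
    hI.mono (Submodule.span_range_inv_norm_smul I)
  obtain ⟨W, _, _, ⟨b⟩⟩ := exists_module_basis 𝕜 (I × ℕ)
  obtain ⟨⟨e, he⟩⟩ : Nonempty (NormProblem (I × ℕ) × ℕ ↪ I) :=
    Cardinal.le_def _ _ |>.1 (mk_normProblem_prod_nat I).le
  -- Level 0 carries `Y`; the higher levels start at zero and are free to be redefined.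
  let T : W →ₗ[𝕜] Y := b.constr 𝕜 fun g => if g.2 = 0 then a g.1 else 0
  have hTb : ∀ s, T (b (s, 0)) = a s := fun s => by simp [T]
  have hT1 : ∀ g, ‖T (b g)‖ ≤ 1 := fun g => by
    simp only [T, b.constr_basis]
    split_ifs
    · exact ha1 _
    · simp
  obtain ⟨N, hN, hN0, hmax⟩ := exists_maximal_repSeminorm e b b.span_eq
    (hXY.2.norm_comp_mem_repSeminorms T hT1)
  obtain ⟨p, rfl⟩ := repSeminorms.exists_seminorm hN
  obtain ⟨E, _, _, _, φ, hφd, hφ⟩ := p.exists_completion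
  have hspan : Dense (Submodule.span 𝕜 (range (φ ∘ b)) : Set E) := by
    rw [range_comp, ← Submodule.map_span, b.span_eq, Submodule.map_top]
    exact hφd
  have hEX : FinitelyRepresentable 𝕜 E X := by
    refine finitelyRepresentable_of_denseRange φ hφd fun F hF δ hδ => ?_
    obtain ⟨_, ⟨S, rfl⟩, hS⟩ := mem_closure_pi_real_iff.1 hN.1 F hF δ hδ
    exact ⟨S, fun w hw => by rw [hφ]; exact (hS w hw).le⟩
  let V := levelSpan 𝕜 b 0
  have hVd : DenseRange (T ∘ₗ V.subtype) := by
    refine had.mono ?_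
    rw [← LinearMap.coe_range]
    refine Submodule.span_le.2 ?_
    rintro _ ⟨s, rfl⟩
    exact ⟨⟨b (s, 0), Submodule.subset_span ⟨_, le_refl 0, rfl⟩⟩, hTb s⟩
  have hVn : ∀ x : V, ‖(φ ∘ₗ V.subtype) x‖ = ‖(T ∘ₗ V.subtype) x‖ := fun x =>
    (hφ x).trans (hN0 x x.2)
  -- On level 0 the seminorm is `‖T ·‖`, so `T x ↦ φ x` is well defined and isometric on a dense
  -- subspace of `Y`.
  let J : Y →L[𝕜] E := (φ ∘ₗ V.subtype).extendOfNorm (T ∘ₗ V.subtype)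
  have hJ : ∀ x : V, J ((T ∘ₗ V.subtype) x) = (φ ∘ₗ V.subtype) x :=
    LinearMap.extendOfNorm_eq hVd ⟨1, fun x => by rw [one_mul, hVn]⟩
  have hJn : ∀ y, ‖J y‖ = ‖y‖ := fun y =>
    hVd.induction_on y (isClosed_eq (by fun_prop) (by fun_prop)) fun x => by rw [hJ, hVn]
  let j : Y →ₗᵢ[𝕜] E := ⟨J, hJn⟩
  refine ⟨E, inferInstance, inferInstance, inferInstance,
    ⟨⟨hXY.1.comp_isometry j, hEX⟩, fun Z _ _ _ hZ i => ?_⟩, ⟨j⟩, le_antisymm ?_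
    (banachDim_le_of_isometry hY j)⟩
  · refine isReflecting_range_of_solves (c := φ ∘ b) (fun g => (hφ _).trans_le (hN.2 g)) hspan i
      fun q z hz hq => ⟨fun k => φ (b (e (q, k), q.level + 1)),
        fun k => (hφ _).trans_le (hN.2 _), ?_⟩
    have := NormProblem.solves_of_extension he b hN hmax hZ.2 (i.toLinearMap ∘ₗ φ)
      (fun w => (i.norm_map _).trans (hφ w)) q z hz hq
    intro k hk
    have h1 : codedSum 𝕜 (Sum.elim (φ ∘ b) fun k => φ (b (e (q, k), q.level + 1))) k.1 =
        φ (codedSum 𝕜 (q.assignment e b) k.1) := by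
      rw [map_codedSum]
      congr 1
      funext t
      rcases t with g | m <;> rfl
    rw [h1, hφ]
    exact this k hk
  · calc banachDim 𝕜 E ≤ #(range (φ ∘ b)) := banachDim_le_mk hspan
      _ ≤ #(I × ℕ) := mk_range_le
      _ = banachDim 𝕜 Y := by rw [← hIc]; simp

theorem theorem2 {𝕜 : Type v} [RCLike 𝕜] (X : Type u) [NormedAddCommGroup X] [NormedSpace 𝕜 X]
    [CompleteSpace X] (hX : ¬ FiniteDimensional 𝕜 X) :
    (∃ (E : Type u) (_ : NormedAddCommGroup E) (_ : NormedSpace 𝕜 E) (_ : CompleteSpace E),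
      IsExistentiallyClosed 𝕜 X E) ∧
    ∀ (Y : Type u) [NormedAddCommGroup Y] [NormedSpace 𝕜 Y] [CompleteSpace Y],
      FinitelyEquivalent 𝕜 X Y →
        ∃ (E : Type u) (_ : NormedAddCommGroup E) (_ : NormedSpace 𝕜 E) (_ : CompleteSpace E),
          IsExistentiallyClosed 𝕜 X E ∧ Nonempty (Y →ₗᵢ[𝕜] E) ∧
            banachDim 𝕜 E = banachDim 𝕜 Y := by
  refine ⟨?_, fun Y _ _ _ hXY => exists_existentiallyClosed_extension hX hXY⟩
  obtain ⟨E, h1, h2, h3, hE, -⟩ := exists_existentiallyClosed_extension hX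
    ⟨FinitelyRepresentable.refl X, FinitelyRepresentable.refl X⟩
  exact ⟨E, h1, h2, h3, hE⟩
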